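/- Let $A$ be a unital complex algebra, $B\subset A$ a subalgebra with $1_B=1_A$, $E:A\to B$ a $B$-functional (a linear map with $E(b)=b$ and $E(bab')=bE(a)b'$ for $a\in A$, $b,b'\in B$), and $\varphi:A\to\mathbb C$ a linear functional with $\varphi(1)=1$. Suppose that $(A,\varphi)$ and $(A,E)$ are compatible, i.e. $\varphi(a)=\varphi(E(a))$ for all $a\in A$. For a non-crossing partition $\pi\in NC(n)$ and $a_1,\dots,a_n\in A$ let $\widehat E(\pi)(a_1,\dots,a_n)\in B$ be the nested moment along $\pi$: a block $v_1<\dots<v_k$ has the value $E(a_{v_1}b_1a_{v_2}b_2\cdots b_{k-1}a_{v_k})$, where $b_j$ is the value of the part of $\pi$ strictly between $v_j$ and $v_{j+1}$ (equal to $1$ if there is none), and $\widehat E(\pi)(a_1,\dots,a_n)$ is the product of the values of the outer blocks from left to right. The $B$-valued cumulants are $K_n(a_1,\dots,a_n)=\sum_{\pi\in NC(n)}\widehat E(\pi)(a_1,\dots,a_n)\,\mu(\pi,1_n)$, where $\mu$ is the Möbius function of the lattice $NC(n)$. Let $\widehat\varphi(\pi)$ and the scalar cumulants $k_n$ be the same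 objects for $B=\mathbb C\cdot 1$ and $E=\varphi$; so $\widehat\varphi(\pi)(a_1,\dots,a_n)=\prod_{V=\{v_1<\dots<v_k\}\in\pi}\varphi(a_{v_1}\cdots a_{v_k})$. Two subsets $X_1,X_2\subset A$ are free over $B$ in $(A,E)$ if $K_n(a_1,\dots,a_n)=0$ whenever each $a_j$ lies in the algebra generated by $B$ and $X_{i_j}$ and $i_1,\dots,i_n\in\{1,2\}$ are not all equal; they are free in $(A,\varphi)$ if the same holds with $\mathbb C\cdot 1$ and $k_n$ in place of $B$ and $K_n$. A finite family $p=(p_i)$ in $A$ has property (*) if $\varphi\bigl(\widehat E(\pi)(p_{i_1},\dots,p_{i_n})\bigr)=\widehat\varphi(\pi)(p_{i_1},\dots,p_{i_n})$ for all $n$, all indices $i_1,\dots,i_n$ and all $\pi\in NC(n)$. Let $x_1,\dots,x_s,y_1,\dots,y_t\in A$ be such that the family $x_1,\dots,x_s,y_1,\dots,y_t$ has property (*). (1) If $\{x_1,\dots,x_s\}$ and $\{y_1,\dots,y_t\}$ are free over $B$ in $(A,E)$, then they are free in $(A,\varphi)$. (2) Suppose moreover that all $x_i$ and $y_j$ are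 central, i.e. commute with every element of $B$, and that $\varphi$ is nondegenerate in the following sense: if $C\subset B$ is the unital subalgebra generated by the moments $E(p_1\cdots p_n)$ with $p_1,\dots,p_n\in\{x_1,\dots,x_s,y_1,\dots,y_t\}$, and $c\in C$ satisfies $\varphi(cd)=0$ for all $d\in C$, then $c=0$. (This holds in particular if $\varphi(b)=0$ implies $b=0$ for all $b\in B$.) Then the converse holds: if $\{x_1,\dots,x_s\}$ and $\{y_1,\dots,y_t\}$ are free in $(A,\varphi)$, they are free over $B$ in $(A,E)$. -/

import Mathlib

open Finset

namespace OpFree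

/-! Non-crossing partitions of `{0, …, n - 1}`, ordered by refinement, and their Möbius function. -/

/-- A partition is non-crossing if there are no `i < j < k < l` with `i, k` in one block
and `j, l` in a different block. -/
def IsNoncrossing {n : ℕ} (π : Finpartition (univ : Finset (Fin n))) : Prop :=
  ∀ i j k l : Fin n, i < j → j < k → k < l →
    π.part i = π.part k → π.part j = π.part l → π.part i = π.part j

/-- The set `NC(n)`; its order is the refinement order inherited from `Finpartition`. -/
abbrev NC (n : ℕ) : Type :=
  {π : Finpartition (univ : Finset (Fin n)) // IsNoncrossing π}

noncomputable instance instFintypeNC (n : ℕ) : Fintype (NC n) := by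
  classical exact inferInstance

noncomputable instance instDecidableEqNC (n : ℕ) : DecidableEq (NC n) := Classical.decEq _

noncomputable instance instLocallyFiniteOrderNC (n : ℕ) : LocallyFiniteOrder (NC n) := by
  classical exact Fintype.toLocallyFiniteOrder

/-- The partition with at most one block (exactly one block if `n` is positive). -/
noncomputable def NC.one (n : ℕ) : NC n := by
  classical exact
  ⟨⊤, by
    intro i j k l _ _ _ _ _
    have hne : (univ : Finset (Fin n)) ≠ ∅ := fun h => by
      have := Finset.mem_univ i
      rw [h] at this
      simp at this
    have key : ∀ m : Fin n, (⊤ : Finpartition (univ : Finset (Fin n))).part m = univ := by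
      intro m
      have h1 := Finpartition.parts_top_subset (univ : Finset (Fin n))
        ((⊤ : Finpartition (univ : Finset (Fin n))).part_mem.2 (Finset.mem_univ m))
      simpa using h1
    rw [key i, key j]⟩

/-! Probability spaces over an algebra `B`. The inclusion of `B` in `A` is written as an algebra
homomorphism `β : B →ₐ[ℂ] A`; it is `B.val` for a subalgebra `B` of `A`, and the map
`z ↦ z • 1` (that is, `Algebra.ofId ℂ A`) in the scalar-valued case. -/

section Space

variable {A B : Type*} [Ring A] [Algebra ℂ A] [Ring B] [Algebra ℂ B]

/-- `E` is a `B`-functional (conditional expectation): `E b = b` and `E (b a b') = b (E a) b'`.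
For `B = ℂ` this says that the linear functional `E` maps `1` to `1`. -/
structure IsBFunctional (β : B →ₐ[ℂ] A) (E : A →ₗ[ℂ] B) : Prop where
  map_base : ∀ b : B, E (β b) = b
  map_bimodule : ∀ (b b' : B) (a : A), E (β b * a * β b') = b * E a * b'

/-- Auxiliary step in reading a word from right to left. The list `L` holds the outer blocks, from
left to right, of the part of the partition read so far; each block comes with its label and the
product of its letters, into which the values of the blocks nested inside it have been inserted.
The new letter `a` belongs to the block with label `c`. If this block is new, it is put in front.
Otherwise the blocks of `L` in front of it become nested in it: the product of their `B`-values
is inserted between `a` and the next letter of the block. -/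
def absorb {κ : Type*} [DecidableEq κ] (β : B →ₐ[ℂ] A) (E : A →ₗ[ℂ] B)
    (c : κ) (a : A) (L : List (κ × A)) : List (κ × A) :=
  match L.dropWhile (fun p => p.1 ≠ c) with
  | [] => (c, a) :: L
  | q :: rest =>
      (c, a * β ((L.takeWhile (fun p => p.1 ≠ c)).map (fun p => E p.2)).prod * q.2) :: rest

/-- The partition-dependent moment `Ê(π)(a₁ ⊗ ⋯ ⊗ aₙ) ∈ B` of a non-crossing partition `π`:
for each block `V = (v₁ < ⋯ < vₖ)` the value is `E (a_{v₁} b₁ a_{v₂} b₂ ⋯ b_{k-1} a_{vₖ})`, where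
`bⱼ` is the value of the part of `π` strictly between `vⱼ` and `vⱼ₊₁`, and the values of the outer
blocks are multiplied from left to right. For instance, `E (a₁ E(a₂) a₃) E(a₄)` belongs to
`{1,3}, {2}, {4}`. -/
def partitionMoment (β : B →ₐ[ℂ] A) (E : A →ₗ[ℂ] B) {n : ℕ}
    (π : Finpartition (univ : Finset (Fin n))) (a : Fin n → A) : B :=
  ((((List.ofFn fun i => (π.part i, a i)).foldr
    (fun p L => absorb β E p.1 p.2 L) []).map (fun p => E p.2))).prod

/-- The `n`-th cumulant `c⁽ⁿ⁾(a₁ ⊗ ⋯ ⊗ aₙ) = ∑_{π ∈ NC(n)} Ê(π)(a₁ ⊗ ⋯ ⊗ aₙ) μ(π, 1ₙ)`. -/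
noncomputable def cumulant (β : B →ₐ[ℂ] A) (E : A →ₗ[ℂ] B) {n : ℕ} (a : Fin n → A) : B :=
  ∑ π : NC n, (IncidenceAlgebra.mu ℤ π (NC.one n)) • partitionMoment β E π.1 a

/-- Freeness over `B` of a family of subsets `X i`: all mixed cumulants of elements of the
subalgebras generated by `B` and the `X i` vanish. -/
def AreFree {I : Type*} (β : B →ₐ[ℂ] A) (E : A →ₗ[ℂ] B) (X : I → Set A) : Prop :=
  ∀ (n : ℕ) (i : Fin n → I) (a : Fin n → A),
    (∀ j, a j ∈ Algebra.adjoin ℂ (Set.range β ∪ X (i j))) →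
    (∃ j k, i j ≠ i k) → cumulant β E a = 0

end Space

section Compatible

variable {A : Type*} [Ring A] [Algebra ℂ A] (B : Subalgebra ℂ A)

/-- Freeness over `B` in `(A, E)`. -/
def FreeOver {I : Type*} (E : A →ₗ[ℂ] B) (X : I → Set A) : Prop :=
  AreFree B.val E X

/-- Freeness in the scalar-valued space `(A, φ)`. -/
def ScalarFree {I : Type*} (φ : A →ₗ[ℂ] ℂ) (X : I → Set A) : Prop :=
  AreFree (Algebra.ofId ℂ A) φ X

/-- Compatibility of `(A, φ)` and `(A, E)`: `φ = φ ∘ E`. -/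
def Compatible (E : A →ₗ[ℂ] B) (φ : A →ₗ[ℂ] ℂ) : Prop :=
  ∀ a : A, φ a = φ (E a : A)

/-- Property (*) of a family `p`: for every non-crossing partition `π` and every word in the `p i`,
applying `φ` to the nested `B`-valued moment along `π` gives the same as replacing the value of
every block of `π` by its scalar value under `φ`. -/
def PropertyStar {I : Type*} (E : A →ₗ[ℂ] B) (φ : A →ₗ[ℂ] ℂ) (p : I → A) : Prop :=
  ∀ (n : ℕ) (i : Fin n → I) (π : NC n),
    φ ((partitionMoment B.val E π.1 (fun j => p (i j)) : B) : A) =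
      partitionMoment (Algebra.ofId ℂ A) φ π.1 (fun j => p (i j))

/-- The unital subalgebra of `B` generated by the `B`-valued moments `E (p_{i₁} ⋯ p_{iₙ})`. -/
def momentAlgebra {I : Type*} (E : A →ₗ[ℂ] B) (p : I → A) : Subalgebra ℂ B :=
  Algebra.adjoin ℂ {b : B | ∃ w : List I, b = E (w.map p).prod}

/-- `φ` is nondegenerate on a subalgebra `D` of `B`: the bilinear form `(c, d) ↦ φ (c d)` on `D`
has trivial radical. If `φ b = 0` only for `b = 0` in `B`, then `φ` is nondegenerate on
every `D` (take `d = 1`). -/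
def NondegenerateOn (φ : A →ₗ[ℂ] ℂ) (D : Subalgebra ℂ B) : Prop :=
  ∀ c ∈ D, (∀ d ∈ D, φ ((c * d : B) : A) = 0) → c = 0

/-- Every member of the family `p` commutes with `B`. -/
def IsCentralFamily {I : Type*} (p : I → A) : Prop :=
  ∀ (i : I) (b : B), p i * (b : A) = (b : A) * p i

end Compatible

end OpFree

namespace OpFree

/-! Property (*) concerns the letters `p i` only, but it passes to monomials. In a nested moment a
letter that is a product may be replaced by its factors, all put in the same block
(`wordMoment_append_prod`). For the empty product, where a letter `1` is deleted, this rests on `E 1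
= 1`, the bimodule property and the absence of crossings. Multilinearity extends (*) to the algebra
generated by the family, and summing against the Möbius function gives `φ (K_n a) = k_n a` there
(`PropertyStar.cumulant_eq`). This proves (1), since scalar freeness tests only elements of that
algebra.

For (2), centrality makes every element of the algebra generated by `B` and `X` a combination of `b
w` with `b` in `B` and `w` a monomial, and the coefficients leave the cumulant on the left
(`cumulant_base_mul`). It remains to show that `K_n(w) = 0` for mixed monomials. This value lies in
the moment algebra `C`, so by nondegeneracy `φ (K_n(w) d) = 0` for all `d` in `C` is enough. If `d`
is a product of moments `E v`, then `Ê(π)(w) d` is again a nested moment: `π` gains a singleton at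
the right end for each factor. Then (*) yields `φ (Ê(π)(w) d) = φ̂(π)(w) z` with `z` independent of
`π` (`PropertyStar.exists_scalar`), hence `φ (K_n(w) d) = k_n(w) z = 0`. -/

theorem notMem_or_exists_split {κ M : Type*} [DecidableEq κ] (c : κ) (S : List (κ × M)) :
    c ∉ S.map Prod.fst ∨ ∃ T q R, S = T ++ (c, q) :: R ∧ c ∉ T.map Prod.fst := by
  induction S with
  | nil => simp
  | cons p S ih =>
    by_cases hp : p.1 = c
    · exact Or.inr ⟨[], p.2, S, by simp [← hp], by simp⟩
    · rcases ih with ih | ⟨T, q, R, rfl, hT⟩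
      · left
        rw [List.map_cons, List.mem_cons, not_or]
        exact ⟨fun h => hp h.symm, ih⟩
      · refine Or.inr ⟨p :: T, q, R, rfl, ?_⟩
        rw [List.map_cons, List.mem_cons, not_or]
        exact ⟨fun h => hp h.symm, hT⟩

/-! ### Nested moments of labelled words. -/

section Words

variable {A B κ : Type*} [Ring A] [Algebra ℂ A] [Ring B] [Algebra ℂ B]
  (β : B →ₐ[ℂ] A) (E : A →ₗ[ℂ] B)

/-- The product of the `B`-values of a list of labelled blocks. -/
def blockProd (S : List (κ × A)) : B := (S.map fun p => E p.2).prod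

@[simp] theorem blockProd_nil : blockProd E ([] : List (κ × A)) = 1 := rfl

@[simp] theorem blockProd_cons (p : κ × A) (S : List (κ × A)) :
    blockProd E (p :: S) = E p.2 * blockProd E S := by
  simp [blockProd]

@[simp] theorem blockProd_append (S T : List (κ × A)) :
    blockProd E (S ++ T) = blockProd E S * blockProd E T := by
  simp [blockProd]

variable [DecidableEq κ]

/-- Reading the labelled word `L` from right to left, starting from the list of blocks `S`. -/
def readWord (L S : List (κ × A)) : List (κ × A) :=
  L.foldr (fun p S => absorb β E p.1 p.2 S) S

/-- The nested moment of a word whose letters are labelled by blocks. -/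
def wordMoment (L : List (κ × A)) : B := blockProd E (readWord β E L [])

@[simp] theorem readWord_nil (S : List (κ × A)) : readWord β E [] S = S := rfl

@[simp] theorem readWord_cons (p : κ × A) (L S : List (κ × A)) :
    readWord β E (p :: L) S = absorb β E p.1 p.2 (readWord β E L S) := rfl

theorem readWord_append (L L' S : List (κ × A)) :
    readWord β E (L ++ L') S = readWord β E L (readWord β E L' S) := by
  simp [readWord]

theorem partitionMoment_eq_wordMoment {n : ℕ} (π : Finpartition (univ : Finset (Fin n)))
    (a : Fin n → A) :
    partitionMoment β E π a = wordMoment β E (List.ofFn fun i => (π.part i, a i)) := rfl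

theorem absorb_of_notMem {c : κ} (a : A) {S : List (κ × A)} (h : c ∉ S.map Prod.fst) :
    absorb β E c a S = (c, a) :: S := by
  have : S.dropWhile (fun p => p.1 ≠ c) = [] := by
    rw [List.dropWhile_eq_nil_iff]
    intro p hp
    simp only [decide_eq_true_eq, ne_eq]
    rintro rfl
    exact h (List.mem_map_of_mem hp)
  rw [absorb, this]

theorem absorb_append {c : κ} (a q : A) {T : List (κ × A)} (R : List (κ × A))
    (h : c ∉ T.map Prod.fst) :
    absorb β E c a (T ++ (c, q) :: R) = (c, a * β (blockProd E T) * q) :: R := by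
  have hT : ∀ p ∈ T, decide (p.1 ≠ c) = true := by
    intro p hp
    simp only [decide_eq_true_eq, ne_eq]
    rintro rfl
    exact h (List.mem_map_of_mem hp)
  have h1 : (T ++ (c, q) :: R).dropWhile (fun p => p.1 ≠ c) = (c, q) :: R := by
    rw [List.dropWhile_append_of_pos hT]
    simp
  have h2 : (T ++ (c, q) :: R).takeWhile (fun p => p.1 ≠ c) = T := by
    rw [List.takeWhile_append_of_pos hT]
    simp
  rw [absorb, h1, h2]
  rfl

/-- After `b` is read its block stands first in the list, so nothing is nested between `a` and `b`.
-/
theorem absorb_absorb (c : κ) (a b : A) (S : List (κ × A)) :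
    absorb β E c a (absorb β E c b S) = absorb β E c (a * b) S := by
  rcases notMem_or_exists_split c S with h | ⟨T, q, R, rfl, h⟩
  · rw [absorb_of_notMem β E b h, absorb_of_notMem β E _ h]
    simpa using absorb_append β E a b (T := []) S (c := c) (by simp)
  · rw [absorb_append β E _ _ _ h, absorb_append β E _ _ _ h]
    simpa [mul_assoc] using
      absorb_append β E a (b * β (blockProd E T) * q) (T := []) R (c := c) (by simp)

theorem map_fst_absorb_sublist (c : κ) (a : A) (S : List (κ × A)) :
    ((absorb β E c a S).map Prod.fst).Sublist (c :: S.map Prod.fst) := by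
  rcases notMem_or_exists_split c S with h | ⟨T, q, R, rfl, h⟩
  · rw [absorb_of_notMem β E _ h]; simp
  · rw [absorb_append β E _ _ _ h]
    simp only [List.map_cons, List.map_append]
    refine List.Sublist.cons_cons _ ?_
    exact ((List.sublist_cons_self _ _).trans (List.sublist_append_right _ _))

/-- Nested blocks drop out, and a block that grows moves to the place of its newest letter. A
forbidden pattern among the remaining labels is therefore already one in the word. -/
theorem map_fst_readWord_sublist (L : List (κ × A)) :
    ((readWord β E L []).map Prod.fst).Sublist (L.map Prod.fst) := by
  induction L with
  | nil => simp
  | cons p L ih =>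
    exact (map_fst_absorb_sublist β E _ _ _).trans (ih.cons_cons _)

/-! Relabelling. -/

theorem absorb_map_label {κ' : Type*} [DecidableEq κ'] (f : κ → κ') (c : κ) (a : A)
    (S : List (κ × A)) (hf : ∀ d ∈ S.map Prod.fst, f d = f c → d = c) :
    absorb β E (f c) a (S.map (Prod.map f id)) = (absorb β E c a S).map (Prod.map f id) := by
  have hval (T : List (κ × A)) : blockProd E (T.map (Prod.map f id)) = blockProd E T := by
    simp [blockProd, Function.comp_def]
  have hnot (T : List (κ × A)) (hT : ∀ d ∈ T.map Prod.fst, f d = f c → d = c)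
      (h : c ∉ T.map Prod.fst) : f c ∉ (T.map (Prod.map f id)).map Prod.fst := by
    intro hm
    rw [List.map_map] at hm
    obtain ⟨p, hp, hpc⟩ := List.mem_map.1 hm
    have hp' : p.1 ∈ T.map Prod.fst := List.mem_map_of_mem hp
    exact h (hT _ hp' hpc ▸ hp')
  rcases notMem_or_exists_split c S with h | ⟨T, q, R, rfl, h⟩
  · rw [absorb_of_notMem β E _ h, absorb_of_notMem β E _ (hnot S hf h)]
    rfl
  · rw [absorb_append β E _ _ _ h, List.map_append, List.map_cons, Prod.map_apply,
      absorb_append β E _ _ _ (hnot T (fun d hd => hf d (by simp at hd ⊢; tauto)) h), hval]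
    rfl

theorem readWord_map_label {κ' : Type*} [DecidableEq κ'] (f : κ → κ') (L : List (κ × A))
    (hf : ∀ c ∈ L.map Prod.fst, ∀ d ∈ L.map Prod.fst, f d = f c → d = c) :
    readWord β E (L.map (Prod.map f id)) [] = (readWord β E L []).map (Prod.map f id) := by
  induction L with
  | nil => rfl
  | cons p L ih =>
    rw [List.map_cons, readWord_cons, readWord_cons, ih, Prod.map_fst, Prod.map_snd, id,
      absorb_map_label]
    · intro d hd
      exact hf _ (by simp) _ (List.mem_cons_of_mem _ ((map_fst_readWord_sublist β E L).subset hd))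
    · intro c hc d hd
      exact hf _ (List.mem_cons_of_mem _ hc) _ (List.mem_cons_of_mem _ hd)

theorem wordMoment_map_label {κ' : Type*} [DecidableEq κ'] (f : κ → κ') (L : List (κ × A))
    (hf : ∀ c ∈ L.map Prod.fst, ∀ d ∈ L.map Prod.fst, f d = f c → d = c) :
    wordMoment β E (L.map (Prod.map f id)) = wordMoment β E L := by
  rw [wordMoment, wordMoment, readWord_map_label β E f L hf]
  simp [blockProd, Function.comp_def]

/-! Linearity in each letter. -/

/-- The invariant behind multilinearity: a single entry depends on `x`, through a linear map. It can
stay as it is, be extended by the new letter, or be swallowed as a nested value, which composes with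
`E` and `β`. -/
theorem absorb_linear (d : κ) (a : A) (U : List (κ × A)) (c : κ) (V : List (κ × A))
    (h : A →ₗ[ℂ] A) :
    ∃ (U' : List (κ × A)) (c' : κ) (V' : List (κ × A)) (h' : A →ₗ[ℂ] A), ∀ x,
      absorb β E d a (U ++ (c, h x) :: V) = U' ++ (c', h' x) :: V' := by
  rcases notMem_or_exists_split d U with hU | ⟨T, q, R, rfl, hT⟩
  · by_cases hdc : d = c
    · subst hdc
      refine ⟨[], d, V, LinearMap.mulLeft ℂ (a * β (blockProd E U)) ∘ₗ h, fun x => ?_⟩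
      rw [absorb_append β E _ _ _ hU]
      rfl
    rcases notMem_or_exists_split d V with hV | ⟨T, q, R, rfl, hT⟩
    · refine ⟨(d, a) :: U, c, V, h, fun x => ?_⟩
      rw [absorb_of_notMem]
      · rfl
      · rw [List.map_append, List.map_cons, List.mem_append, List.mem_cons]
        tauto
    · refine ⟨[], d, R, LinearMap.mulLeft ℂ (a * β (blockProd E U)) ∘ₗ
        LinearMap.mulRight ℂ (β (blockProd E T) * q) ∘ₗ β.toLinearMap ∘ₗ E ∘ₗ h, fun x => ?_⟩
      have := absorb_append β E a q R (c := d) (T := U ++ (c, h x) :: T) (by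
        rw [List.map_append, List.map_cons, List.mem_append, List.mem_cons]
        tauto)
      rw [List.append_assoc, List.cons_append] at this
      rw [this]
      simp [mul_assoc]
  · refine ⟨(d, a * β (blockProd E T) * q) :: R, c, V, h, fun x => ?_⟩
    rw [List.append_assoc, List.cons_append, absorb_append β E _ _ _ hT]
    rfl

theorem exists_linearMap_blockProd_readWord (L U : List (κ × A)) (c : κ) (V : List (κ × A))
    (h : A →ₗ[ℂ] A) :
    ∃ g : A →ₗ[ℂ] B, ∀ x, blockProd E (readWord β E L (U ++ (c, h x) :: V)) = g x := by
  induction L using List.reverseRecOn generalizing U c V h with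
  | nil =>
    refine ⟨LinearMap.mulLeft ℂ (blockProd E U) ∘ₗ LinearMap.mulRight ℂ (blockProd E V) ∘ₗ E ∘ₗ h,
      fun x => ?_⟩
    simp
  | append_singleton L p ih =>
    obtain ⟨U', c', V', h', h1⟩ := absorb_linear β E p.1 p.2 U c V h
    obtain ⟨g, hg⟩ := ih U' c' V' h'
    refine ⟨g, fun x => ?_⟩
    rw [readWord_append, readWord_cons, readWord_nil, h1, hg]

theorem exists_linearMap_wordMoment (L L' : List (κ × A)) (c : κ) :
    ∃ g : A →ₗ[ℂ] B, ∀ x, wordMoment β E (L ++ (c, x) :: L') = g x := by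
  rcases notMem_or_exists_split c (readWord β E L' []) with h | ⟨T, q, R, hS, h⟩
  · obtain ⟨g, hg⟩ := exists_linearMap_blockProd_readWord β E L [] c (readWord β E L' [])
      LinearMap.id
    refine ⟨g, fun x => ?_⟩
    rw [wordMoment, readWord_append, readWord_cons, absorb_of_notMem β E _ h, ← hg]
    rfl
  · obtain ⟨g, hg⟩ := exists_linearMap_blockProd_readWord β E L [] c R
      (LinearMap.mulRight ℂ (β (blockProd E T) * q))
    refine ⟨g, fun x => ?_⟩
    rw [wordMoment, readWord_append, readWord_cons, hS, absorb_append β E _ _ _ h, ← hg]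
    simp [mul_assoc]

/-! Letters equal to `1`. -/

variable {β E}

theorem IsBFunctional.map_one (hE : IsBFunctional β E) : E 1 = 1 := by
  simpa using hE.map_base 1

/-- Blocks that receive no further letters contribute only their `B`-value, at their place in the
product. By the bimodule property this value may stand next to `E x` or be multiplied into `x`. -/
theorem blockProd_readWord_collapse (hE : IsBFunctional β E) (L V U₁ U₂ S : List (κ × A)) (c : κ)
    (x : A) (h₁ : ∀ u ∈ U₁.map Prod.fst, u ∉ L.map Prod.fst)
    (h₂ : ∀ u ∈ U₂.map Prod.fst, u ∉ L.map Prod.fst) :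
    blockProd E (readWord β E L
        (V ++ (c, β (blockProd E U₁) * x * β (blockProd E U₂)) :: S)) =
      blockProd E (readWord β E L (V ++ (U₁ ++ (c, x) :: (U₂ ++ S)))) := by
  induction L using List.reverseRecOn generalizing V U₁ x S with
  | nil => simp [← mul_assoc, hE.map_bimodule]
  | append_singleton L p ih =>
    obtain ⟨d, a⟩ := p
    have hd₁ : d ∉ U₁.map Prod.fst := fun h => h₁ d h (by simp)
    have hd₂ : d ∉ U₂.map Prod.fst := fun h => h₂ d h (by simp)
    replace h₁ : ∀ u ∈ U₁.map Prod.fst, u ∉ L.map Prod.fst := fun u hu h => h₁ u hu (by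
      rw [List.map_append]; exact List.mem_append_left _ h)
    replace h₂ : ∀ u ∈ U₂.map Prod.fst, u ∉ L.map Prod.fst := fun u hu h => h₂ u hu (by
      rw [List.map_append]; exact List.mem_append_left _ h)
    simp only [readWord_append, readWord_cons, readWord_nil]
    rcases notMem_or_exists_split d V with hV | ⟨T, q, R, rfl, hT⟩
    · by_cases hdc : d = c
      · subst hdc
        rw [absorb_append β E _ _ _ hV, ← List.append_assoc, absorb_append β E _ _ (U₂ ++ S)
          (by rw [List.map_append, List.mem_append]; tauto)]
        -- Both readings now hold `U₁` inside the block, so only `U₂` is left to compare.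
        simpa [mul_assoc] using ih [] [] S (a * β (blockProd E V) * (β (blockProd E U₁) * x))
          (by simp) h₂
      rcases notMem_or_exists_split d S with hS | ⟨T, q, R, rfl, hT⟩
      · rw [absorb_of_notMem, absorb_of_notMem, ← List.cons_append, ih _ _ _ _ h₁ h₂]
        · rfl
        · simp only [List.map_append, List.map_cons, List.mem_append, List.mem_cons]
          tauto
        · simp only [List.map_append, List.map_cons, List.mem_append, List.mem_cons]
          tauto
      · have e₁ := absorb_append β E a q R (c := d)
          (T := V ++ (c, β (blockProd E U₁) * x * β (blockProd E U₂)) :: T) (by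
            simp only [List.map_append, List.map_cons, List.mem_append, List.mem_cons]
            tauto)
        have e₂ := absorb_append β E a q R (c := d) (T := V ++ (U₁ ++ (c, x) :: (U₂ ++ T))) (by
            simp only [List.map_append, List.map_cons, List.mem_append, List.mem_cons]
            tauto)
        simp only [List.append_assoc, List.cons_append] at e₁ e₂
        rw [e₁, e₂]
        simp [← mul_assoc, hE.map_bimodule]
    · rw [List.append_assoc, List.cons_append, absorb_append β E _ _ _ hT, List.append_assoc,
        List.cons_append, absorb_append β E _ _ _ hT, ← List.cons_append, ih _ _ _ _ h₁ h₂]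
      rfl

/-- An entry `1` is harmless until its block gains a letter. Then the blocks of `V` become nested in
`c`, although without the `1` they would stay outside; excluding `u, c, u` makes them complete, so
`blockProd_readWord_collapse` applies. -/
theorem blockProd_readWord_one (hE : IsBFunctional β E) (L V S : List (κ × A)) (c : κ)
    (hV : c ∉ V.map Prod.fst) (hS : c ∉ S.map Prod.fst)
    (h : ∀ u, u ≠ c → ¬ [u, c, u].Sublist (L.map Prod.fst ++ V.map Prod.fst)) :
    blockProd E (readWord β E L (V ++ (c, 1) :: S)) = blockProd E (readWord β E L (V ++ S)) := by
  induction L using List.reverseRecOn generalizing V with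
  | nil => simp [hE.map_one]
  | append_singleton L p ih =>
    obtain ⟨d, a⟩ := p
    simp only [readWord_append, readWord_cons, readWord_nil]
    simp only [List.map_append, List.map_cons, List.map_nil, List.append_assoc,
      List.cons_append, List.nil_append] at h
    rcases notMem_or_exists_split d V with hdV | ⟨T, q, R, rfl, hT⟩
    · by_cases hdc : d = c
      · subst hdc
        rw [absorb_append β E _ _ _ hdV, absorb_of_notMem β E _
          (by rw [List.map_append, List.mem_append]; tauto)]
        have := blockProd_readWord_collapse hE L [] [] V S d a (by simp) (fun u hu huL => by
          refine h u (fun e => hV (e ▸ hu)) ?_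
          exact (List.singleton_sublist.2 huL).append
            ((List.singleton_sublist.2 hu).cons_cons d))
        simpa using this
      rcases notMem_or_exists_split d S with hdS | ⟨T, q, R, rfl, hT⟩
      · rw [absorb_of_notMem, absorb_of_notMem, ← List.cons_append, ih]
        · rfl
        · rw [List.map_cons, List.mem_cons]
          exact not_or.2 ⟨fun e => hdc e.symm, hV⟩
        · exact h
        · rw [List.map_append, List.mem_append]; tauto
        · rw [List.map_append, List.map_cons, List.mem_append, List.mem_cons]; tauto
      · have e₁ := absorb_append β E a q R (c := d) (T := V ++ (c, 1) :: T) (by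
            simp only [List.map_append, List.map_cons, List.mem_append, List.mem_cons]
            tauto)
        have e₂ := absorb_append β E a q R (c := d) (T := V ++ T) (by
            simp only [List.map_append, List.mem_append]
            tauto)
        simp only [List.append_assoc, List.cons_append] at e₁ e₂
        rw [e₁, e₂]
        simp [hE.map_one]
    · rw [List.append_assoc, List.cons_append, absorb_append β E _ _ _ hT, List.append_assoc,
        List.cons_append, absorb_append β E _ _ _ hT, ← List.cons_append, ih]
      · rfl
      · rw [List.map_append, List.map_cons, List.mem_append, List.mem_cons] at hV
        rw [List.map_cons, List.mem_cons]
        tauto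
      · intro u hu hs
        refine h u hu (hs.trans ?_)
        simp only [List.map_append, List.map_cons]
        exact (List.Sublist.refl _).append
          ((List.sublist_append_right _ _).trans (List.sublist_cons_self _ _))

/-- A list of labels is non-crossing if it has no subsequence `a, b, a, b` with `a ≠ b`. -/
def NoncrossingList (l : List κ) : Prop := ∀ a b, a ≠ b → ¬ [a, b, a, b].Sublist l

/-- If `1` is the rightmost letter of its block, it completes a pattern `u, c, u` on its left to a
crossing. Otherwise the blocks `T` that it encloses are complete, since a further letter `u` would
give `u, c, u, c`. -/
theorem wordMoment_append_one_cons (hE : IsBFunctional β E) (L L' : List (κ × A)) (c : κ)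
    (h : NoncrossingList (L.map Prod.fst ++ c :: L'.map Prod.fst)) :
    wordMoment β E (L ++ (c, 1) :: L') = wordMoment β E (L ++ L') := by
  rw [wordMoment, wordMoment, readWord_append, readWord_cons, readWord_append]
  have hs := map_fst_readWord_sublist β E L'
  rcases notMem_or_exists_split c (readWord β E L' []) with hc | ⟨T, q, R, hS, hc⟩
  · rw [absorb_of_notMem β E _ hc]
    refine blockProd_readWord_one hE L [] _ c (by simp) hc fun u hu hl => h u c hu ?_
    simp only [List.map_nil, List.append_nil] at hl
    exact hl.append (List.singleton_sublist.2 List.mem_cons_self)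
  · rw [hS] at hs
    rw [hS, absorb_append β E _ _ _ hc]
    have := blockProd_readWord_collapse hE L [] T [] R c q (fun u hu huL => by
      refine h u c (fun e => hc (e ▸ hu)) ?_
      refine (List.singleton_sublist.2 huL).append (List.Sublist.cons_cons c ?_)
      refine List.Sublist.trans ?_ hs
      rw [List.map_append]
      exact (List.singleton_sublist.2 hu).append (List.singleton_sublist.2 (by simp))) (by simp)
    simpa using this

theorem wordMoment_append_prod (hE : IsBFunctional β E) (L L' : List (κ × A)) (c : κ) (w : List A)
    (h : NoncrossingList (L.map Prod.fst ++ c :: L'.map Prod.fst)) :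
    wordMoment β E (L ++ (c, w.prod) :: L') = wordMoment β E (L ++ (w.map (Prod.mk c) ++ L')) := by
  rcases w with _ | ⟨a, w⟩
  · simpa using wordMoment_append_one_cons hE L L' c h
  -- A nonempty product is split by `absorb_absorb` alone, whatever the labels.
  clear h
  induction w generalizing L a with
  | nil => simp
  | cons b w ih =>
    have := ih (L ++ [(c, a)]) b
    simp only [List.append_assoc, List.cons_append, List.nil_append] at this
    rw [List.map_cons, List.cons_append, ← this, List.prod_cons]
    simp only [wordMoment, readWord_append, readWord_cons, absorb_absorb]

end Words

/-! ### Non-crossing sequences of labels. -/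

section Noncrossing

variable {κ : Type*}

theorem NoncrossingList.append_singleton {l : List κ} (h : NoncrossingList l) {c : κ}
    (hc : c ∉ l) : NoncrossingList (l ++ [c]) := by
  intro a b hab hs
  obtain ⟨u, v, huv, hu, hv⟩ := List.sublist_append_iff.1 hs
  rcases List.sublist_singleton.1 hv with rfl | rfl
  · rw [List.append_nil] at huv
    exact h a b hab (huv ▸ hu)
  · have h2 : [a, b, a] ++ [b] = u ++ [c] := huv
    obtain ⟨rfl, h3⟩ := List.append_inj' h2 rfl
    rw [List.singleton_inj] at h3
    subst h3
    exact hc (hu.subset (by simp))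

/-- A run carries one label, so a sequence with distinct neighbours takes at most one term from it.
Expanding letters into runs, possibly empty, thus creates no crossing. -/
theorem sublist_labels_of_sublist_flatMap {ι : Type*} {l : List κ} (hl : l.IsChain (· ≠ ·))
    (L : List (κ × List ι)) (hs : l.Sublist (L.flatMap fun p => p.2.map fun _ => p.1)) :
    l.Sublist (L.map Prod.fst) := by
  induction L generalizing l with
  | nil => simpa using hs
  | cons p L ih =>
    rw [List.flatMap_cons] at hs
    obtain ⟨u, v, rfl, hu, hv⟩ := List.sublist_append_iff.1 hs
    have hv' := ih hl.right_of_append hv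
    have hmem : ∀ z ∈ u, z = p.1 := by
      intro z hz
      obtain ⟨_, _, h⟩ := List.mem_map.1 (hu.subset hz)
      exact h.symm
    match u with
    | [] => exact hv'.trans (List.sublist_cons_self _ _)
    | [z] =>
      rw [hmem z (by simp)]
      exact hv'.cons_cons _
    | z :: z' :: u =>
      have h0 : z ≠ z' := by
        have := hl.left_of_append
        simp only [List.isChain_cons_cons] at this
        exact this.1
      exact absurd ((hmem z (by simp)).trans (hmem z' (by simp)).symm) h0

theorem NoncrossingList.append_flatMap {ι : Type*} {l : List κ} {L : List (κ × List ι)}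
    (h : NoncrossingList (l ++ L.map Prod.fst)) :
    NoncrossingList (l ++ L.flatMap fun p => p.2.map fun _ => p.1) := by
  intro a b hab hs
  obtain ⟨u, v, huv, hu, hv⟩ := List.sublist_append_iff.1 hs
  refine h a b hab ?_
  have hc : [a, b, a, b].IsChain (· ≠ ·) := by simp [hab, hab.symm]
  rw [huv] at hc ⊢
  exact hu.append (sublist_labels_of_sublist_flatMap hc.right_of_append L hv)

theorem noncrossingList_ofFn {n : ℕ} {c : Fin n → κ}
    (h : ∀ i j k l : Fin n, i < j → j < k → k < l → c i = c k → c j = c l → c i = c j) :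
    NoncrossingList (List.ofFn c) := by
  intro a b hab hs
  obtain ⟨f, hf⟩ := List.sublist_iff_exists_fin_orderEmbedding_get_eq.1 hs
  have hlt (i j : Fin 4) (hij : i < j) : f i < f j := f.lt_iff_lt.2 hij
  simp only [List.get_ofFn] at hf
  have h0 : a = _ := hf 0
  have h1 : b = _ := hf 1
  have h2 : a = _ := hf 2
  have h3 : b = _ := hf 3
  exact hab (h0.trans ((h _ _ _ _ (hlt 0 1 (by decide)) (hlt 1 2 (by decide))
    (hlt 2 3 (by decide)) (h0.symm.trans h2) (h1.symm.trans h3)).trans h1.symm))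

theorem NoncrossingList.get {l : List κ} (h : NoncrossingList l) {i j k m : Fin l.length}
    (hij : i < j) (hjk : j < k) (hkm : k < m) (h₁ : l.get i = l.get k) (h₂ : l.get j = l.get m) :
    l.get i = l.get j := by
  by_contra hne
  refine h _ _ hne ?_
  have := List.map_getElem_sublist (l := l) (is := [i, j, k, m])
    (by simp [hij, hjk, hkm, hij.trans hjk, hjk.trans hkm, (hij.trans hjk).trans hkm])
  simp only [List.get_eq_getElem] at h₁ h₂ ⊢
  simpa [← h₁, ← h₂] using this

/-- The partition of `Fin n` into the fibres of `c`. -/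
noncomputable def fiberPartition {n : ℕ} (c : Fin n → κ) :
    Finpartition (univ : Finset (Fin n)) := by
  classical exact Finpartition.ofSetoid (Setoid.ker c)

theorem part_fiberPartition_eq_iff {n : ℕ} (c : Fin n → κ) (i j : Fin n) :
    (fiberPartition c).part i = (fiberPartition c).part j ↔ c i = c j := by
  classical
  rw [← Finpartition.mem_part_iff_part_eq_part _ (mem_univ i) (mem_univ j), fiberPartition,
    Finpartition.mem_part_ofSetoid_iff_rel]
  exact eq_comm

end Noncrossing

/-! ### Passage between partitions and labelled words. -/

section Relabel

variable {A B : Type*} [Ring A] [Algebra ℂ A] [Ring B] [Algebra ℂ B]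
  (β : B →ₐ[ℂ] A) (E : A →ₗ[ℂ] B)

theorem wordMoment_ofFn_congr {n : ℕ} {κ κ' : Type*} [DecidableEq κ] [DecidableEq κ']
    (c : Fin n → κ) (c' : Fin n → κ') (a : Fin n → A) (h : ∀ i j, c i = c j ↔ c' i = c' j) :
    wordMoment β E (List.ofFn fun i => (c i, a i)) =
      wordMoment β E (List.ofFn fun i => (c' i, a i)) := by
  rcases n with _ | n
  · simp [wordMoment]
  have hf (i) : (c' ∘ Function.invFun c) (c i) = c' i :=
    (h _ _).1 (Function.invFun_eq ⟨i, rfl⟩)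
  rw [← wordMoment_map_label β E (c' ∘ Function.invFun c)]
  · rw [List.map_ofFn]
    congr 2
    funext i
    exact Prod.ext (hf i) rfl
  · intro x hx y hy hxy
    rw [List.map_ofFn] at hx hy
    obtain ⟨i, rfl⟩ := List.mem_ofFn.1 hx
    obtain ⟨j, rfl⟩ := List.mem_ofFn.1 hy
    simp only [Function.comp_apply (f := Prod.fst)] at hxy ⊢
    rw [hf, hf] at hxy
    exact (h _ _).2 hxy

/-- Labels in `ℕ` of the blocks of a partition. -/
noncomputable def blockLabel {n : ℕ} (π : Finpartition (univ : Finset (Fin n))) (i : Fin n) : ℕ :=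
  Encodable.encode (π.part i)

theorem blockLabel_eq_iff {n : ℕ} (π : Finpartition (univ : Finset (Fin n))) (i j : Fin n) :
    blockLabel π i = blockLabel π j ↔ π.part i = π.part j :=
  Encodable.encode_inj

/-- The label type `ℕ` does not vary with `n` and always has a fresh label, so a word can be
lengthened or given a new singleton block. -/
theorem partitionMoment_eq_wordMoment_blockLabel {n : ℕ}
    (π : Finpartition (univ : Finset (Fin n))) (a : Fin n → A) :
    partitionMoment β E π a = wordMoment β E (List.ofFn fun i => (blockLabel π i, a i)) :=
  wordMoment_ofFn_congr β E _ _ a fun i j => (blockLabel_eq_iff π i j).symm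

theorem NC.noncrossingList {n : ℕ} (π : NC n) :
    NoncrossingList (List.ofFn (blockLabel π.1)) := by
  refine noncrossingList_ofFn fun i j k l hij hjk hkl h₁ h₂ => ?_
  rw [blockLabel_eq_iff] at *
  exact π.2 i j k l hij hjk hkl h₁ h₂

/-- The non-crossing partition of the positions of a word given by non-crossing labels. -/
noncomputable def NC.ofLabels {κ I : Type*} (L : List (κ × I))
    (h : NoncrossingList (L.map Prod.fst)) : NC L.length :=
  ⟨fiberPartition fun j => (L.get j).1, by
    intro i j k l hij hjk hkl h₁ h₂
    rw [part_fiberPartition_eq_iff] at *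
    let e : Fin L.length ≃o Fin (L.map Prod.fst).length := Fin.castOrderIso (by simp)
    have := h.get (e.lt_iff_lt.2 hij) (e.lt_iff_lt.2 hjk) (e.lt_iff_lt.2 hkl)
    simpa [e, h₁, h₂] using this (by simpa [e] using h₁) (by simpa [e] using h₂)⟩

theorem partitionMoment_ofLabels {κ I : Type*} [DecidableEq κ] (L : List (κ × I))
    (h : NoncrossingList (L.map Prod.fst)) (p : I → A) :
    partitionMoment β E (NC.ofLabels L h).1 (fun j => p (L.get j).2) =
      wordMoment β E (L.map (Prod.map id p)) := by
  refine (wordMoment_ofFn_congr β E _ (fun j => (L.get j).1) _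
    (fun i j => part_fiberPartition_eq_iff (fun j => (L.get j).1) i j)).trans ?_
  congr 1
  refine List.ext_getElem (by simp) fun k h₁ h₂ => ?_
  simp [Prod.map]

end Relabel

/-! ### Multilinearity of moments and cumulants. -/

section Multilinear

theorem MultilinearMap.eq_zero_of_mem_span {ι R M N : Type*} [Finite ι] [CommSemiring R]
    [AddCommMonoid M] [AddCommMonoid N] [Module R M] [Module R N]
    (f : MultilinearMap R (fun _ : ι => M) N) (S : ι → Set M)
    (hf : ∀ a, (∀ j, a j ∈ S j) → f a = 0) {a : ι → M}
    (ha : ∀ j, a j ∈ Submodule.span R (S j)) : f a = 0 := by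
  classical
  have := Fintype.ofFinite ι
  -- `s` is the set of positions where elements of the span are allowed; it grows one position at a
  -- time.
  have key (s : Finset ι) : ∀ a : ι → M, (∀ j ∈ s, a j ∈ Submodule.span R (S j)) →
      (∀ j ∉ s, a j ∈ S j) → f a = 0 := by
    induction s using Finset.induction_on with
    | empty => exact fun a _ h => hf a fun j => h j (by simp)
    | insert j s hj ih =>
      intro a h₁ h₂
      have h (x : M) (hx : x ∈ Submodule.span R (S j)) : f (Function.update a j x) = 0 := by
        induction hx using Submodule.span_induction with
        | mem x hx =>
          refine ih _ (fun k hk => ?_) fun k hk => ?_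
          · rw [Function.update_of_ne (by rintro rfl; exact hj hk)]
            exact h₁ k (mem_insert_of_mem hk)
          · by_cases hkj : k = j
            · subst hkj; simpa using hx
            · rw [Function.update_of_ne hkj]
              exact h₂ k (by simp [hkj, hk])
        | zero => exact f.map_update_zero a j
        | add x y _ _ hx hy => rw [f.map_update_add, hx, hy, add_zero]
        | smul r x _ hx => rw [f.map_update_smul, hx, smul_zero]
      simpa using h (a j) (h₁ j (mem_insert_self _ _))
  exact key univ a (fun j _ => ha j) (by simp)

theorem exists_ofFn_update {n : ℕ} {κ M : Type*} [DecidableEq (Fin n)] (c : Fin n → κ) (m : Fin n → M) (i : Fin n) :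
    ∃ L L' : List (κ × M), ∀ x, List.ofFn (fun j => (c j, Function.update m i x j)) =
      L ++ (c i, x) :: L' := by
  refine ⟨(List.ofFn fun j => (c j, m j)).take i, (List.ofFn fun j => (c j, m j)).drop (i + 1),
    fun x => ?_⟩
  have h := List.set_eq_take_append_cons_drop (l := List.ofFn fun j => (c j, m j)) (i := i)
    (a := (c i, x))
  rw [if_pos (by simp)] at h
  rw [← h]
  refine List.ext_getElem (by simp) fun k h₁ h₂ => ?_
  rw [List.getElem_set, List.getElem_ofFn, List.getElem_ofFn]
  split_ifs with hk
  · have : (⟨k, by simpa using h₁⟩ : Fin n) = i := Fin.ext hk.symm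
    simp [this]
  · rw [Function.update_of_ne]
    exact fun e => hk (congrArg Fin.val e).symm

variable {A B : Type*} [Ring A] [Algebra ℂ A] [Ring B] [Algebra ℂ B]
  (β : B →ₐ[ℂ] A) (E : A →ₗ[ℂ] B)

/-- The partition-dependent moment as a multilinear map. -/
def partitionMomentMultilinear {n : ℕ} (π : Finpartition (univ : Finset (Fin n))) :
    MultilinearMap ℂ (fun _ : Fin n => A) B where
  toFun := partitionMoment β E π
  map_update_add' m i x y := by
    obtain ⟨L, L', h⟩ := exists_ofFn_update (blockLabel π) m i
    obtain ⟨g, hg⟩ := exists_linearMap_wordMoment β E L L' (blockLabel π i)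
    simp only [partitionMoment_eq_wordMoment_blockLabel, h, hg, map_add]
  map_update_smul' m i z x := by
    obtain ⟨L, L', h⟩ := exists_ofFn_update (blockLabel π) m i
    obtain ⟨g, hg⟩ := exists_linearMap_wordMoment β E L L' (blockLabel π i)
    simp only [partitionMoment_eq_wordMoment_blockLabel, h, hg, map_smul]

@[simp] theorem partitionMomentMultilinear_apply {n : ℕ}
    (π : Finpartition (univ : Finset (Fin n))) (a : Fin n → A) :
    partitionMomentMultilinear β E π a = partitionMoment β E π a := rfl

/-- The cumulant as a multilinear map. -/
noncomputable def cumulantMultilinear (n : ℕ) : MultilinearMap ℂ (fun _ : Fin n => A) B :=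
  ∑ π : NC n, (IncidenceAlgebra.mu ℤ π (NC.one n) : ℂ) • partitionMomentMultilinear β E π.1

@[simp] theorem cumulantMultilinear_apply {n : ℕ} (a : Fin n → A) :
    cumulantMultilinear β E n a = cumulant β E a := by
  simp [cumulantMultilinear, cumulant, Int.cast_smul_eq_zsmul]

end Multilinear

/-! ### Central coefficients, and expansion of monomials into letters. -/

section Letters

variable {A B κ I : Type*} [Ring A] [Algebra ℂ A] [Ring B] [Algebra ℂ B]
  {β : B →ₐ[ℂ] A} {E : A →ₗ[ℂ] B}

theorem IsBFunctional.map_mul_left (hE : IsBFunctional β E) (b : B) (a : A) :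
    E (β b * a) = b * E a := by
  simpa using hE.map_bimodule b 1 a

theorem IsBFunctional.map_mul_right (hE : IsBFunctional β E) (b : B) (a : A) :
    E (a * β b) = E a * b := by
  simpa using hE.map_bimodule 1 b a

/-- Both sides equal `E (b a) = E (a b)`. -/
theorem IsBFunctional.commute_map (hE : IsBFunctional β E) {a : A}
    (ha : a ∈ Subalgebra.centralizer ℂ (Set.range β)) (b : B) : b * E a = E a * b := by
  rw [← hE.map_mul_left, ← hE.map_mul_right, (Subalgebra.mem_centralizer_iff ℂ).1 ha _ ⟨b, rfl⟩]

theorem IsBFunctional.commute_blockProd (hE : IsBFunctional β E) {S : List (κ × A)}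
    (hS : ∀ q ∈ S, q.2 ∈ Subalgebra.centralizer ℂ (Set.range β)) (b : B) :
    b * blockProd E S = blockProd E S * b := by
  induction S with
  | nil => simp
  | cons q S ih =>
    rw [blockProd_cons, ← mul_assoc, hE.commute_map (hS q (by simp)), mul_assoc,
      ih fun q hq => hS q (List.mem_cons_of_mem _ hq), mul_assoc]

/-- A labelled letter with a coefficient from `B` in front. -/
def scaleLetter (β : B →ₐ[ℂ] A) (t : κ × B × A) : κ × A := (t.1, β t.2.1 * t.2.2)

/-- A labelled letter without its coefficient. -/
def bareLetter (t : κ × B × A) : κ × A := (t.1, t.2.2)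

theorem blockProd_map_scaleLetter (hE : IsBFunctional β E) (T : List (κ × B × A))
    (hT : ∀ t ∈ T, t.2.2 ∈ Subalgebra.centralizer ℂ (Set.range β)) :
    blockProd E (T.map (scaleLetter β)) =
      (T.map fun t => t.2.1).prod * blockProd E (T.map bareLetter) := by
  induction T with
  | nil => simp
  | cons t T ih =>
    rw [List.map_cons, List.map_cons, List.map_cons, blockProd_cons, blockProd_cons,
      ih fun t ht => hT t (List.mem_cons_of_mem _ ht), List.prod_cons]
    simp only [scaleLetter, bareLetter]
    rw [hE.map_mul_left, mul_assoc, ← mul_assoc (E _), ← hE.commute_map (hT t (by simp))]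
    simp only [mul_assoc]

/-- The products of the members of a family `p` that lie in `X`. -/
def wordsIn (p : I → A) (X : Set A) : Set A :=
  {a | ∃ w : List I, (∀ i ∈ w, p i ∈ X) ∧ a = (w.map p).prod}

theorem closure_subset_wordsIn {A I : Type*} [Ring A] (p : I → A) {X : Set A} (hX : X ⊆ Set.range p) :
    (Submonoid.closure X : Set A) ⊆ wordsIn p X := by
  intro a ha
  induction ha using Submonoid.closure_induction_left with
  | one => exact ⟨[], by simp⟩
  | mul_left x hx y _ ih =>
    obtain ⟨w, hw, rfl⟩ := ih
    obtain ⟨i, rfl⟩ := hX hx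
    exact ⟨i :: w, by simpa using ⟨hx, hw⟩, by simp⟩

theorem mem_span_wordsIn (p : I → A) {a : A} (ha : a ∈ Algebra.adjoin ℂ (Set.range p)) :
    a ∈ Submodule.span ℂ (wordsIn p (Set.range p)) := by
  rw [← Subalgebra.mem_toSubmodule, Algebra.adjoin_eq_span] at ha
  exact Submodule.span_mono (closure_subset_wordsIn p subset_rfl) ha

/-- As `X` commutes with `B`, the coefficients in a product can be collected at its front. -/
theorem mem_span_base_mul_wordsIn (p : I → A) {X : Set A} (hX : X ⊆ Set.range p)
    (hc : X ⊆ Subalgebra.centralizer ℂ (Set.range β)) {a : A}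
    (ha : a ∈ Algebra.adjoin ℂ (Set.range β ∪ X)) :
    a ∈ Submodule.span ℂ {z | ∃ b : B, ∃ w ∈ wordsIn p X, z = β b * w} := by
  rw [← Subalgebra.mem_toSubmodule, Algebra.adjoin_eq_span] at ha
  refine Submodule.span_mono ?_ ha
  intro a ha
  induction ha using Submonoid.closure_induction_right with
  | one => exact ⟨1, 1, ⟨[], by simp⟩, by simp⟩
  | mul_right y _ x hx ih =>
    obtain ⟨b, _, ⟨w, hw, rfl⟩, rfl⟩ := ih
    rcases hx with ⟨b', rfl⟩ | hx
    · refine ⟨b * b', _, ⟨w, hw, rfl⟩, ?_⟩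
      have : (w.map p).prod ∈ Subalgebra.centralizer ℂ (Set.range β) := by
        refine Subalgebra.list_prod_mem _ fun z hz => ?_
        obtain ⟨i, hi, rfl⟩ := List.mem_map.1 hz
        exact hc (hw i hi)
      rw [mul_assoc, ← (Subalgebra.mem_centralizer_iff ℂ).1 this _ ⟨b', rfl⟩, map_mul, mul_assoc]
    · obtain ⟨i, rfl⟩ := hX hx
      refine ⟨b, _, ⟨w ++ [i], ?_, rfl⟩, by simp [mul_assoc]⟩
      intro j hj
      rcases List.mem_append.1 hj with hj | hj
      · exact hw j hj
      · rw [List.mem_singleton.1 hj]; exact hx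

variable [DecidableEq κ]

/-- The prefix `L'` serves the induction: the rightmost letters are expanded first, so each further
letter has an expanded word on its right. -/
theorem wordMoment_append_words (hE : IsBFunctional β E) (p : I → A) (L' : List (κ × A))
    (L : List (κ × List I)) (h : NoncrossingList (L'.map Prod.fst ++ L.map Prod.fst)) :
    wordMoment β E (L' ++ L.map (Prod.map id fun w => (w.map p).prod)) =
      wordMoment β E (L' ++ (L.flatMap fun q => q.2.map (Prod.mk q.1)).map (Prod.map id p)) := by
  induction L generalizing L' with
  | nil => rfl
  | cons q L ih =>
    obtain ⟨c, w⟩ := q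
    have h₁ := ih (L' ++ [(c, (w.map p).prod)]) (by simpa using h)
    have h₂ := wordMoment_append_prod hE L'
      ((L.flatMap fun q => q.2.map (Prod.mk q.1)).map (Prod.map id p)) c (w.map p) (by
        have : NoncrossingList ((L'.map Prod.fst ++ [c]) ++ L.map Prod.fst) := by simpa using h
        simpa [List.map_flatMap, Function.comp_def] using this.append_flatMap)
    simp only [List.append_assoc, List.cons_append, List.nil_append] at h₁
    rw [List.map_cons, Prod.map_apply, id, h₁, h₂, List.flatMap_cons, List.map_append]
    simp [Function.comp_def]

theorem wordMoment_words (hE : IsBFunctional β E) (p : I → A) (L : List (κ × List I))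
    (h : NoncrossingList (L.map Prod.fst)) :
    wordMoment β E (L.map (Prod.map id fun w => (w.map p).prod)) =
      wordMoment β E ((L.flatMap fun q => q.2.map (Prod.mk q.1)).map (Prod.map id p)) := by
  simpa using wordMoment_append_words hE p [] L (by simpa using h)

variable (β E) in
theorem readWord_append_right (L S R : List (κ × A))
    (h : ∀ c ∈ L.map Prod.fst, c ∉ R.map Prod.fst) :
    readWord β E L (S ++ R) = readWord β E L S ++ R := by
  induction L with
  | nil => rfl
  | cons p L ih =>
    rw [readWord_cons, readWord_cons, ih fun c hc => h c (List.mem_cons_of_mem _ hc)]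
    have hp : p.1 ∉ R.map Prod.fst := h _ (by simp)
    rcases notMem_or_exists_split p.1 (readWord β E L S) with hS | ⟨T, q, U, hS, hT⟩
    · rw [absorb_of_notMem β E _ hS, absorb_of_notMem]
      · rfl
      · rw [List.map_append, List.mem_append]; tauto
    · rw [hS, List.append_assoc, List.cons_append, absorb_append β E _ _ _ hT,
        absorb_append β E _ _ _ hT]
      rfl

variable (β E) in
theorem wordMoment_append_singleton (L : List (κ × A)) (c : κ) (x : A)
    (h : c ∉ L.map Prod.fst) :
    wordMoment β E (L ++ [(c, x)]) = wordMoment β E L * E x := by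
  have hr := readWord_append_right β E L [] [(c, x)] (by
    intro d hd
    simp only [List.map_cons, List.map_nil, List.mem_singleton]
    rintro rfl
    exact h hd)
  rw [wordMoment, readWord_append, readWord_cons, readWord_nil,
    absorb_of_notMem β E x (S := []) (by simp)]
  rw [List.nil_append] at hr
  rw [hr, blockProd_append, wordMoment]
  simp

/-- Both readings see the same labels and hence make the same choices; one list `S` of labels,
coefficients and central parts records them together. -/
theorem exists_readWord_scaleLetter (hE : IsBFunctional β E) (T : List (κ × B × A))
    (hT : ∀ t ∈ T, t.2.2 ∈ Subalgebra.centralizer ℂ (Set.range β)) :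
    ∃ S : List (κ × B × A), readWord β E (T.map (scaleLetter β)) [] = S.map (scaleLetter β) ∧
      readWord β E (T.map bareLetter) [] = S.map bareLetter ∧
      (S.map fun t => t.2.1).prod = (T.map fun t => t.2.1).prod ∧
      ∀ t ∈ S, t.2.2 ∈ Subalgebra.centralizer ℂ (Set.range β) := by
  induction T with
  | nil => exact ⟨[], by simp⟩
  | cons t T ih =>
    obtain ⟨S, h₁, h₂, h₃, hS⟩ := ih fun t ht => hT t (List.mem_cons_of_mem _ ht)
    obtain ⟨c, b, x⟩ := t
    have hx : x ∈ Subalgebra.centralizer ℂ (Set.range β) := hT (c, b, x) (by simp)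
    simp only [List.map_cons, readWord_cons, h₁, h₂, List.prod_cons, ← h₃]
    have hs (R : List (κ × B × A)) : (R.map (scaleLetter β)).map Prod.fst = R.map Prod.fst := by
      simp [scaleLetter, Function.comp_def]
    have hb (R : List (κ × B × A)) : (R.map bareLetter).map Prod.fst = R.map Prod.fst := by
      simp [bareLetter, Function.comp_def]
    rcases notMem_or_exists_split c S with hc | ⟨U, q, R, rfl, hU⟩
    · refine ⟨(c, b, x) :: S, ?_, ?_, by simp, ?_⟩
      · exact absorb_of_notMem β E _ (by rw [hs]; exact hc)
      · exact absorb_of_notMem β E _ (by rw [hb]; exact hc)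
      · intro t ht
        rcases List.mem_cons.1 ht with rfl | ht
        exacts [hx, hS t ht]
    · obtain ⟨d, y⟩ := q
      have hUc : ∀ t ∈ U, t.2.2 ∈ Subalgebra.centralizer ℂ (Set.range β) :=
        fun t ht => hS t (by simp [ht])
      have hy : y ∈ Subalgebra.centralizer ℂ (Set.range β) := hS (c, d, y) (by simp)
      have hP : β (blockProd E (U.map bareLetter)) ∈
          Subalgebra.centralizer ℂ (Set.range β) := by
        rw [Subalgebra.mem_centralizer_iff]
        rintro _ ⟨b, rfl⟩
        rw [← map_mul, ← map_mul, hE.commute_blockProd]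
        intro q hq
        obtain ⟨t, ht, rfl⟩ := List.mem_map.1 hq
        exact hUc t ht
      -- `B` need not be commutative: the coefficients keep their order, with the nested ones
      -- between `b` and `d`.
      refine ⟨(c, b * (U.map fun t => t.2.1).prod * d,
        x * β (blockProd E (U.map bareLetter)) * y) :: R, ?_, ?_, ?_, ?_⟩
      · rw [List.map_append, List.map_cons]
        simp only [scaleLetter]
        rw [absorb_append β E _ _ _ (by rw [← hs] at hU; exact hU)]
        rw [blockProd_map_scaleLetter hE U hUc, List.map_cons]
        congr 2
        have e₁ := fun b => (Subalgebra.mem_centralizer_iff ℂ).1 hx (β b) ⟨b, rfl⟩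
        have e₂ := fun b => (Subalgebra.mem_centralizer_iff ℂ).1 hP (β b) ⟨b, rfl⟩
        simp only [map_mul]
        generalize β (blockProd E (U.map bareLetter)) = P at *
        generalize (U.map fun t => t.2.1).prod = u at *
        calc β b * x * (β u * P) * (β d * y) = β b * (x * β u) * (P * β d) * y := by
              simp only [mul_assoc]
          _ = β b * (β u * x) * (β d * P) * y := by rw [← e₁, ← e₂]
          _ = β b * β u * (x * β d) * P * y := by simp only [mul_assoc]
          _ = β b * β u * (β d * x) * P * y := by rw [← e₁]
          _ = _ := by simp only [mul_assoc]
      · rw [List.map_append, List.map_cons]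
        simp only [bareLetter]
        rw [absorb_append β E _ _ _ (by rw [← hb] at hU; exact hU)]
        rfl
      · simp [mul_assoc]
      · intro t ht
        rcases List.mem_cons.1 ht with rfl | ht
        · exact mul_mem (mul_mem hx hP) hy
        · exact hS t (by simp [ht])

theorem wordMoment_map_scaleLetter (hE : IsBFunctional β E) (T : List (κ × B × A))
    (hT : ∀ t ∈ T, t.2.2 ∈ Subalgebra.centralizer ℂ (Set.range β)) :
    wordMoment β E (T.map (scaleLetter β)) =
      (T.map fun t => t.2.1).prod * wordMoment β E (T.map bareLetter) := by
  obtain ⟨S, h₁, h₂, h₃, hS⟩ := exists_readWord_scaleLetter hE T hT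
  rw [wordMoment, wordMoment, h₁, h₂, ← h₃, blockProd_map_scaleLetter hE S hS]

theorem cumulant_base_mul (hE : IsBFunctional β E) {n : ℕ} (b : Fin n → B) (w : Fin n → A)
    (hw : ∀ j, w j ∈ Subalgebra.centralizer ℂ (Set.range β)) :
    cumulant β E (fun j => β (b j) * w j) = (List.ofFn b).prod * cumulant β E w := by
  rw [cumulant, cumulant, Finset.mul_sum]
  refine Finset.sum_congr rfl fun π _ => ?_
  rw [mul_smul_comm, partitionMoment_eq_wordMoment_blockLabel,
    partitionMoment_eq_wordMoment_blockLabel]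
  have := wordMoment_map_scaleLetter hE (List.ofFn fun j => (blockLabel π.1 j, b j, w j)) (by
    intro t ht
    obtain ⟨j, rfl⟩ := List.mem_ofFn.1 ht
    exact hw j)
  rw [List.map_ofFn, List.map_ofFn, List.map_ofFn] at this
  exact congrArg _ this

/-- Every entry stays of the form `β d * w` with `d` in `C` and `w` in `W`: nested values lie in `C`
and move to the front because `W` commutes with `B`. -/
theorem wordMoment_mem (hE : IsBFunctional β E) (C : Subalgebra ℂ B) (W : Submonoid A)
    (hW : ∀ w ∈ W, w ∈ Subalgebra.centralizer ℂ (Set.range β)) (hC : ∀ w ∈ W, E w ∈ C)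
    (L : List (κ × A)) (hL : ∀ q ∈ L, q.2 ∈ W) : wordMoment β E L ∈ C := by
  have hprod (S : List (κ × A)) (hS : ∀ q ∈ S, ∃ d ∈ C, ∃ w ∈ W, q.2 = β d * w) :
      blockProd E S ∈ C := by
    refine C.list_prod_mem fun z hz => ?_
    obtain ⟨q, hq, rfl⟩ := List.mem_map.1 hz
    obtain ⟨d, hd, w, hw, e⟩ := hS q hq
    rw [e, hE.map_mul_left]
    exact mul_mem hd (hC w hw)
  refine hprod _ ?_
  induction L with
  | nil => simp
  | cons p L ih =>
    have ih' := ih fun q hq => hL q (List.mem_cons_of_mem _ hq)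
    have hp := hL p (by simp)
    rw [readWord_cons]
    rcases notMem_or_exists_split p.1 (readWord β E L []) with hS | ⟨T, r, R, hS, hT⟩
    · rw [absorb_of_notMem β E _ hS]
      intro q hq
      rcases List.mem_cons.1 hq with rfl | hq
      · exact ⟨1, one_mem C, p.2, hp, by simp⟩
      · exact ih' q hq
    · rw [hS] at ih' ⊢
      rw [absorb_append β E _ _ _ hT]
      intro q hq
      rcases List.mem_cons.1 hq with rfl | hq
      · obtain ⟨d, hd, w, hw, e⟩ := ih' (p.1, r) (by simp)
        refine ⟨blockProd E T * d, mul_mem (hprod T fun q hq => ih' q (by simp [hq])) hd,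
          p.2 * w, mul_mem hp hw, ?_⟩
        simp only at e
        rw [e, map_mul]
        have := fun b => (Subalgebra.mem_centralizer_iff ℂ).1 (hW _ hp) (β b) ⟨b, rfl⟩
        simp only [← mul_assoc]
        rw [← this, mul_assoc (β _) p.2, ← this, mul_assoc (β _) (β _) p.2]
      · exact ih' q (by simp [hq])

end Letters

/-! ### Transfer between `E` and `φ`, and the two implications. -/

section Compatible

variable {A I : Type*} [Ring A] [Algebra ℂ A] {B : Subalgebra ℂ A} {E : A →ₗ[ℂ] B}
  {φ : A →ₗ[ℂ] ℂ} {p : I → A}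

/-- Once the monomials are expanded into letters, both sides are moments along one partition of the
longer word, where (*) applies. -/
theorem PropertyStar.wordMoment_eq {κ : Type*} [DecidableEq κ] (hstar : PropertyStar B E φ p)
    (hE : IsBFunctional B.val E) (hφ : IsBFunctional (Algebra.ofId ℂ A) φ)
    (L : List (κ × List I)) (hL : NoncrossingList (L.map Prod.fst)) :
    φ (wordMoment B.val E (L.map (Prod.map id fun w => (w.map p).prod)) : B) =
      wordMoment (Algebra.ofId ℂ A) φ (L.map (Prod.map id fun w => (w.map p).prod)) := by
  have hF : NoncrossingList ((L.flatMap fun q => q.2.map (Prod.mk q.1)).map Prod.fst) := by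
    have := NoncrossingList.append_flatMap (l := []) (L := L) (by simpa using hL)
    simpa [List.map_flatMap, Function.comp_def] using this
  rw [wordMoment_words hE p L hL, wordMoment_words hφ p L hL, ← partitionMoment_ofLabels _ _ _ hF,
    ← partitionMoment_ofLabels _ _ _ hF]
  exact hstar _ _ _

theorem PropertyStar.partitionMoment_eq (hstar : PropertyStar B E φ p)
    (hE : IsBFunctional B.val E) (hφ : IsBFunctional (Algebra.ofId ℂ A) φ) {n : ℕ} (π : NC n)
    {a : Fin n → A} (ha : ∀ j, a j ∈ Algebra.adjoin ℂ (Set.range p)) :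
    φ (partitionMoment B.val E π.1 a : B) = partitionMoment (Algebra.ofId ℂ A) φ π.1 a := by
  have := MultilinearMap.eq_zero_of_mem_span
    ((φ ∘ₗ B.val.toLinearMap).compMultilinearMap (partitionMomentMultilinear B.val E π.1) -
      partitionMomentMultilinear (Algebra.ofId ℂ A) φ π.1)
    (fun _ => wordsIn p (Set.range p)) (fun a ha => ?_) (fun j => mem_span_wordsIn p (ha j))
  · exact sub_eq_zero.1 this
  · choose w _ hw using ha
    obtain rfl := funext hw
    refine sub_eq_zero.2 ?_
    have := hstar.wordMoment_eq hE hφ (List.ofFn fun j => (blockLabel π.1 j, w j))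
      (by rw [List.map_ofFn]; exact π.noncrossingList)
    rw [List.map_ofFn] at this
    simp only [LinearMap.compMultilinearMap_apply, partitionMomentMultilinear_apply,
      partitionMoment_eq_wordMoment_blockLabel]
    exact this

theorem map_cumulant (f : B →ₗ[ℂ] ℂ) {n : ℕ} (a : Fin n → A) (z : ℂ)
    (h : ∀ π : NC n, f (partitionMoment B.val E π.1 a) =
      partitionMoment (Algebra.ofId ℂ A) φ π.1 a * z) :
    f (cumulant B.val E a) = cumulant (Algebra.ofId ℂ A) φ a * z := by
  simp only [cumulant, map_sum, map_zsmul, h, Finset.sum_mul, smul_mul_assoc]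

theorem PropertyStar.cumulant_eq (hstar : PropertyStar B E φ p)
    (hE : IsBFunctional B.val E) (hφ : IsBFunctional (Algebra.ofId ℂ A) φ) {n : ℕ}
    {a : Fin n → A} (ha : ∀ j, a j ∈ Algebra.adjoin ℂ (Set.range p)) :
    φ (cumulant B.val E a : B) = cumulant (Algebra.ofId ℂ A) φ a := by
  have := map_cumulant (φ := φ) (φ ∘ₗ B.val.toLinearMap) a 1 fun π => by
    simpa using hstar.partitionMoment_eq hE hφ π ha
  simpa using this

theorem adjoin_range_ofId_union (X : Set A) :
    Algebra.adjoin ℂ (Set.range (Algebra.ofId ℂ A) ∪ X) = Algebra.adjoin ℂ X := by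
  refine le_antisymm (Algebra.adjoin_le ?_) (Algebra.adjoin_mono Set.subset_union_right)
  rintro _ (⟨z, rfl⟩ | hx)
  · exact (Algebra.adjoin ℂ X).algebraMap_mem z
  · exact Algebra.subset_adjoin hx

theorem PropertyStar.scalarFree {J : Type*} (hstar : PropertyStar B E φ p)
    (hE : IsBFunctional B.val E) (hφ : IsBFunctional (Algebra.ofId ℂ A) φ) {X : J → Set A}
    (hX : ∀ j, X j ⊆ Set.range p) (h : FreeOver B E X) : ScalarFree φ X := by
  intro n i a ha hne
  simp only [adjoin_range_ofId_union] at ha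
  rw [← hstar.cumulant_eq hE hφ fun j => Algebra.adjoin_mono (hX _) (ha j),
    h n i a (fun j => Algebra.adjoin_mono Set.subset_union_right (ha j)) hne]
  simp

/-- The scalar must not depend on `L`; only then does it factor out of the Möbius sum. A factor `E
w` of `d` is taken up as a singleton block with a fresh label at the right end of the word. -/
theorem PropertyStar.exists_scalar (hstar : PropertyStar B E φ p)
    (hE : IsBFunctional B.val E) (hφ : IsBFunctional (Algebra.ofId ℂ A) φ) {d : B}
    (hd : d ∈ momentAlgebra B E p) :
    ∃ z : ℂ, ∀ L : List (ℕ × List I), NoncrossingList (L.map Prod.fst) →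
      φ ((wordMoment B.val E (L.map (Prod.map id fun w => (w.map p).prod)) * d : B) : A) =
        wordMoment (Algebra.ofId ℂ A) φ (L.map (Prod.map id fun w => (w.map p).prod)) * z := by
  rw [momentAlgebra, ← Subalgebra.mem_toSubmodule, Algebra.adjoin_eq_span] at hd
  induction hd using Submodule.span_induction with
  | mem d hd =>
    induction hd using Submonoid.closure_induction_left with
    | one => exact ⟨1, fun L hL => by simpa using hstar.wordMoment_eq hE hφ L hL⟩
    | mul_left x hx y _ ih =>
      obtain ⟨w, rfl⟩ := hx
      obtain ⟨z, hz⟩ := ih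
      refine ⟨φ (w.map p).prod * z, fun L hL => ?_⟩
      obtain ⟨c, hc⟩ := Infinite.exists_notMem_finset (L.map Prod.fst).toFinset
      rw [List.mem_toFinset] at hc
      have := hz (L ++ [(c, w)]) (by
        rw [List.map_append]
        exact hL.append_singleton hc)
      have hc' : c ∉ (L.map (Prod.map id fun w => (w.map p).prod)).map Prod.fst := by
        rw [List.map_map]
        exact hc
      rw [List.map_append, List.map_cons, List.map_nil, Prod.map_apply, id,
        wordMoment_append_singleton _ _ _ _ _ hc', wordMoment_append_singleton _ _ _ _ _ hc'] at this
      rw [← mul_assoc, this, mul_assoc]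
  | zero => exact ⟨0, fun L _ => by simp⟩
  | add x y _ _ hx hy =>
    obtain ⟨z, hz⟩ := hx
    obtain ⟨z', hz'⟩ := hy
    exact ⟨z + z', fun L hL => by rw [mul_add, B.coe_add, map_add, hz L hL, hz' L hL, mul_add]⟩
  | smul r x _ hx =>
    obtain ⟨z, hz⟩ := hx
    exact ⟨r * z, fun L hL => by
      rw [mul_smul_comm, B.coe_smul, map_smul, hz L hL, smul_eq_mul, mul_left_comm]⟩

theorem IsCentralFamily.mem_centralizer (hp : IsCentralFamily B p) (i : I) :
    p i ∈ Subalgebra.centralizer ℂ (Set.range B.val) := by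
  rw [Subalgebra.mem_centralizer_iff]
  rintro _ ⟨b, rfl⟩
  exact (hp i b).symm

theorem IsCentralFamily.list_prod_mem_centralizer (hp : IsCentralFamily B p) (w : List I) :
    (w.map p).prod ∈ Subalgebra.centralizer ℂ (Set.range B.val) := by
  refine Subalgebra.list_prod_mem _ fun z hz => ?_
  obtain ⟨i, _, rfl⟩ := List.mem_map.1 hz
  exact hp.mem_centralizer i

theorem IsCentralFamily.cumulant_mem (hp : IsCentralFamily B p) (hE : IsBFunctional B.val E)
    {n : ℕ} (w : Fin n → List I) :
    cumulant B.val E (fun j => ((w j).map p).prod) ∈ momentAlgebra B E p := by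
  refine Subalgebra.sum_mem _ fun π _ => zsmul_mem ?_ _
  rw [partitionMoment_eq_wordMoment]
  have hW (a : A) (ha : a ∈ Submonoid.closure (Set.range p)) : ∃ w : List I, a = (w.map p).prod :=
    (closure_subset_wordsIn p subset_rfl ha).imp fun _ h => h.2
  refine wordMoment_mem hE _ (Submonoid.closure (Set.range p)) (fun a ha => ?_) (fun a ha => ?_) _
    fun q hq => ?_
  · obtain ⟨w, rfl⟩ := hW a ha
    exact hp.list_prod_mem_centralizer w
  · obtain ⟨w, rfl⟩ := hW a ha
    exact Algebra.subset_adjoin ⟨w, rfl⟩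
  · obtain ⟨j, rfl⟩ := List.mem_ofFn.1 hq
    refine Submonoid.list_prod_mem _ fun z hz => ?_
    obtain ⟨i, _, rfl⟩ := List.mem_map.1 hz
    exact Submonoid.subset_closure ⟨i, rfl⟩

theorem PropertyStar.freeOver {J : Type*} (hstar : PropertyStar B E φ p)
    (hE : IsBFunctional B.val E) (hφ : IsBFunctional (Algebra.ofId ℂ A) φ) {X : J → Set A}
    (hX : ∀ j, X j ⊆ Set.range p) (hnd : NondegenerateOn B φ (momentAlgebra B E p))
    (hp : IsCentralFamily B p) (h : ScalarFree φ X) : FreeOver B E X := by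
  intro n i a ha hne
  have hc (j : J) : X j ⊆ Subalgebra.centralizer ℂ (Set.range B.val) := by
    intro x hx
    obtain ⟨k, rfl⟩ := hX j hx
    exact hp.mem_centralizer k
  rw [← cumulantMultilinear_apply]
  refine MultilinearMap.eq_zero_of_mem_span _ _ (fun a ha => ?_)
    fun j => mem_span_base_mul_wordsIn p (hX (i j)) (hc (i j)) (ha j)
  choose b w hw hab using ha
  choose v hv hwv using hw
  obtain rfl := funext hwv
  obtain rfl := funext hab
  rw [cumulantMultilinear_apply,
    cumulant_base_mul hE b _ fun j => hp.list_prod_mem_centralizer (v j)]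
  -- Without coefficients from `B`, the arguments lie in the algebras to which scalar freeness
  -- applies.
  suffices h0 : cumulant B.val E (fun j => ((v j).map p).prod) = 0 by rw [h0, mul_zero]
  refine hnd _ (hp.cumulant_mem hE v) fun d hd => ?_
  obtain ⟨z, hz⟩ := hstar.exists_scalar hE hφ hd
  have := map_cumulant (E := E) (φ := φ)
    (φ ∘ₗ B.val.toLinearMap ∘ₗ LinearMap.mulRight ℂ d) (fun j => ((v j).map p).prod) z
    fun π => by
      have := hz (List.ofFn fun j => (blockLabel π.1 j, v j))
        (by rw [List.map_ofFn]; exact π.noncrossingList)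
      rw [List.map_ofFn] at this
      rw [partitionMoment_eq_wordMoment_blockLabel, partitionMoment_eq_wordMoment_blockLabel]
      exact this
  rw [h n i _ (fun j => ?_) hne, zero_mul] at this
  · exact this
  · refine Subalgebra.list_prod_mem _ fun y hy => ?_
    obtain ⟨k, hk, rfl⟩ := List.mem_map.1 hy
    exact Algebra.subset_adjoin (Or.inr (hv j k hk))

end Compatible

end OpFree

theorem mainTheorem1 {A : Type*} [Ring A] [Algebra ℂ A] (B : Subalgebra ℂ A)
    (E : A →ₗ[ℂ] B) (φ : A →ₗ[ℂ] ℂ)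
    (hE : OpFree.IsBFunctional B.val E)
    (hφ : OpFree.IsBFunctional (Algebra.ofId ℂ A) φ)
    (hcomp : OpFree.Compatible B E φ)
    {s t : ℕ} (x : Fin s → A) (y : Fin t → A)
    (hstar : OpFree.PropertyStar B E φ (Sum.elim x y)) :
    (OpFree.FreeOver B E ![Set.range x, Set.range y] →
      OpFree.ScalarFree φ ![Set.range x, Set.range y]) ∧
    (OpFree.NondegenerateOn B φ (OpFree.momentAlgebra B E (Sum.elim x y)) →
      OpFree.IsCentralFamily B x → OpFree.IsCentralFamily B y →
      OpFree.ScalarFree φ ![Set.range x, Set.range y] →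
      OpFree.FreeOver B E ![Set.range x, Set.range y]) := by
  have hX (j : Fin 2) : ![Set.range x, Set.range y] j ⊆ Set.range (Sum.elim x y) := by
    rw [Set.Sum.elim_range]
    fin_cases j
    exacts [Set.subset_union_left, Set.subset_union_right]
  refine ⟨hstar.scalarFree hE hφ hX, fun hnd hx hy => hstar.freeOver hE hφ hX hnd ?_⟩
  rintro (i | i) b
  exacts [hx i b, hy i b]
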